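/- All groups are finite. A formation is an isomorphism-closed class $\mathfrak F$ of groups that is closed under quotients and such that $G/(M\cap N)\in\mathfrak F$ whenever $M,N\lhd G$ and $G/M,\,G/N\in\mathfrak F$. It is saturated if $G/\Phi(G)\in\mathfrak F$ implies $G\in\mathfrak F$, where $\Phi(G)$ is the Frattini subgroup. A subgroup $H$ of $G$ is $\mathfrak F$-subnormal in $G$ if there is a chain of subgroups $H=H_0<H_1<\dots<H_n=G$ with $n\ge 0$ such that, for $1\le i\le n$, $H_{i-1}$ is a maximal subgroup of $H_i$ and $H_i/\bigcap_{h\in H_i}H_{i-1}^h\in\mathfrak F$. A formation $\mathfrak F$ closed under subnormal subgroups is superradical if it contains every group $G=AB$ in which $A$ and $B$ are $\mathfrak F$-subnormal subgroups of $G$ that belong to $\mathfrak F$. A primary cyclic subgroup is a cyclic subgroup of prime power order; a subgroup is self-normalizing if it equals its normalizer in $G$; a Carter subgroup is a nilpotent self-normalizing subgroup; $G'$ is the derived subgroup of $G$. Theorem. Let $\mathfrak F$ be a subgroup-closed saturated superradical formation containing all nilpotent groups, and let $G$ be a soluble group with $G\notin\mathfrak F$. Then the following statements are equivalent. (1) Every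 primary cyclic subgroup of $G$ is self-normalizing or $\mathfrak F$-subnormal in $G$. (2) Every proper subgroup of $G$ is self-normalizing or $\mathfrak F$-subnormal in $G$. (3) There are a prime $p$ dividing $|G|$ and an element $x\in G$ such that $G=G'\rtimes\langle x\rangle$, the subgroup $\langle x\rangle$ is a Sylow $p$-subgroup and a Carter subgroup of $G$, and $G'\rtimes\langle x^p\rangle\in\mathfrak F$. -/

import Mathlib

open scoped Pointwise

universe u

namespace GroupFormation

/-- A class of groups, given as a predicate on groups. -/
abbrev GroupClass : Type (u + 1) := ∀ (G : Type u) [Group G], Prop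

/-- A formation: an isomorphism-closed class of finite groups that is closed under
quotients and such that `G ⧸ (M ⊓ N)` is in the class whenever `G ⧸ M` and `G ⧸ N` are. -/
structure IsFormation (F : GroupClass.{u}) : Prop where
  finite : ∀ (G : Type u) [Group G], F G → Finite G
  iso : ∀ (G H : Type u) [Group G] [Group H], (G ≃* H) → F G → F H
  quotient : ∀ (G : Type u) [Group G] (N : Subgroup G) [N.Normal], F G → F (G ⧸ N)
  inf_quotient : ∀ (G : Type u) [Group G] [Finite G] (M N : Subgroup G) [M.Normal] [N.Normal],
    F (G ⧸ M) → F (G ⧸ N) → F (G ⧸ (M ⊓ N))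

/-- A class of groups is subgroup-closed if it contains all subgroups of its members. -/
def IsSubgroupClosed (F : GroupClass.{u}) : Prop :=
  ∀ (G : Type u) [Group G] (H : Subgroup G), F G → F H

/-- A class of finite groups is saturated if `G / Φ(G) ∈ F` implies `G ∈ F`,
for every finite group `G` with Frattini subgroup `Φ(G)`. -/
def IsSaturated (F : GroupClass.{u}) : Prop :=
  ∀ (G : Type u) [Group G] [Finite G], F (G ⧸ frattini G) → F G

/-- The class contains all finite nilpotent groups. -/
def ContainsNilpotent (F : GroupClass.{u}) : Prop :=
  ∀ (G : Type u) [Group G] [Finite G], Group.IsNilpotent G → F G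

/-- `H` is `F`-subnormal in `G` if there is a chain `H = H₀ < H₁ < ⋯ < Hₙ = G` (`n ≥ 0`) in
which each `Hᵢ` is a maximal subgroup of `Hᵢ₊₁` and the quotient of `Hᵢ₊₁` by the core of `Hᵢ`
in `Hᵢ₊₁` belongs to `F`. -/
inductive IsFSubnormal (F : GroupClass.{u}) {G : Type u} [Group G] : Subgroup G → Prop where
  | top : IsFSubnormal F (⊤ : Subgroup G)
  | step (H K : Subgroup G) (hmax : H ⋖ K) (hquot : F (K ⧸ (H.subgroupOf K).normalCore))
      (hK : IsFSubnormal F K) : IsFSubnormal F H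

/-- A formation closed under subnormal subgroups is superradical if it contains every finite
group `G = AB` in which `A` and `B` are `F`-subnormal subgroups belonging to `F`. -/
structure IsSuperradical (F : GroupClass.{u}) : Prop extends IsFormation F where
  subnormal : ∀ (G : Type u) [Group G] (H : Subgroup G), H.IsSubnormal → F G → F H
  product : ∀ (G : Type u) [Group G] [Finite G] (A B : Subgroup G),
    IsFSubnormal F A → IsFSubnormal F B → F A → F B →
    (A : Set G) * (B : Set G) = Set.univ → F G

variable {G : Type u} [Group G]

/-- A subgroup that equals its own normalizer. -/
def IsSelfNormalizing (H : Subgroup G) : Prop := Subgroup.normalizer (H : Set G) = H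

/-- A primary cyclic subgroup: a cyclic subgroup of prime power order. -/
def IsPrimaryCyclic (H : Subgroup G) : Prop := IsCyclic H ∧ IsPrimePow (Nat.card H)

/-- A Carter subgroup: a nilpotent self-normalizing subgroup. -/
def IsCarter (H : Subgroup G) : Prop := Group.IsNilpotent H ∧ IsSelfNormalizing H

end GroupFormation

/-!
The heart of the matter is that a finite soluble group `G` all of whose primary cyclic subgroups
are `F`-subnormal belongs to `F` (`mem_of_forall_isPrimaryCyclic_isFSubnormal`). Indeed, take a
maximal subgroup `A` containing the derived subgroup. Intersecting chains with `A` shows that `A`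
inherits the hypothesis, so `A ∈ F` by induction on the order, and `A` is `F`-subnormal because
`G / A` is abelian. An element `y ∉ A` of prime power order gives `G = A⟨y⟩`, a product of two
`F`-subnormal `F`-subgroups, and superradicality applies.

If `G ∉ F` and every primary cyclic subgroup is self-normalizing or `F`-subnormal, then some
primary cyclic subgroup `C` is not `F`-subnormal, hence self-normalizing. A self-normalizing
`p`-subgroup is Sylow; Burnside's transfer theorem gives a normal complement of `C`, and the
Frattini argument gives `G = G'C`, so that this complement is `G'`
(`isComplement'_commutator_of_sylow`). With `C = ⟨x⟩`, the subgroup `M = G'⟨x ^ p⟩` is proper and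
contains `G'`, so it cannot contain a self-normalizing primary cyclic subgroup `D`, for which
`G = G'D`. Thus all primary cyclic subgroups of `M` are `F`-subnormal, and `M ∈ F`.

Conversely, let `G = G' ⋊ ⟨x⟩` be as in the third condition. A subgroup of `M ∈ F` is `F`-subnormal
in `M`, hence in `G`. A subgroup `H` not contained in `M` satisfies `G'H = G`, so it contains a
conjugate of the self-normalizing Sylow subgroup `⟨x⟩` (`G'` having order prime to `p`), and is
self-normalizing by the Frattini argument.
-/

namespace GroupFormation

variable {F : GroupClass.{u}}

/-! ### Quotients in a subgroup-closed formation -/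

theorem isNilpotent_of_isMulCommutative {G : Type*} [Group G] [IsMulCommutative G] :
    Group.IsNilpotent G :=
  letI : CommGroup G := { ‹Group G› with mul_comm := mul_comm' }
  CommGroup.isNilpotent

theorem IsFormation.of_surjective (hF : IsFormation F) {A B : Type u} [Group A] [Group B]
    (f : A →* B) (hf : Function.Surjective f) (hA : F A) : F B :=
  hF.iso _ _ (QuotientGroup.quotientKerEquivOfSurjective f hf) (hF.quotient A f.ker hA)

/-- A quotient `A ⧸ N` is a section of `Q` as soon as some homomorphism `A →* Q` has its kernel
inside `N`; this turns most membership questions into questions about kernels. -/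
theorem IsFormation.quotient_of_ker_le (hF : IsFormation F) (hsub : IsSubgroupClosed F)
    {A Q : Type u} [Group A] [Group Q] (φ : A →* Q) (hQ : F Q) (N : Subgroup A) [N.Normal]
    (hN : φ.ker ≤ N) : F (A ⧸ N) :=
  hF.of_surjective (QuotientGroup.map φ.ker N (MonoidHom.id A) hN)
    (QuotientGroup.map_surjective_of_surjective φ.ker N (MonoidHom.id A)
      (QuotientGroup.mk'_surjective N) hN)
    (hF.iso _ _ (QuotientGroup.quotientKerEquivRange φ).symm (hsub _ _ hQ))

/-! ### `F`-subnormal subgroups -/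

/-- If `R` is `F`-subnormal in `G` and `S ≤ R` contains the kernel of a homomorphism from `R` to a
group in `F`, then any maximal chain from `S` to `R` witnesses that `S` is `F`-subnormal in `G`.
This spares all later arguments the maximality condition in the definition. -/
theorem isFSubnormal_of_ker_le (hF : IsFormation F) (hsub : IsSubgroupClosed F)
    {G Q : Type u} [Group G] [Finite G] [Group Q] {R : Subgroup G} (hR : IsFSubnormal F R)
    (φ : R →* Q) (hQ : F Q) (S : Subgroup G) (hSR : S ≤ R) (hker : φ.ker ≤ S.subgroupOf R) :
    IsFSubnormal F S := by
  induction S using WellFoundedGT.induction with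
  | ind S ih =>
    rcases hSR.eq_or_lt with rfl | hlt
    · exact hR
    obtain ⟨T, hST, hTR⟩ := hlt.exists_covby_le
    refine .step S T hST (hF.quotient_of_ker_le hsub (φ.comp (Subgroup.inclusion hTR)) hQ _ ?_)
      (ih T hST.lt hTR (hker.trans fun r hr ↦ hST.le hr))
    exact Subgroup.normal_le_normalCore.mpr fun t ht ↦
      hker (show Subgroup.inclusion hTR t ∈ φ.ker from ht)

/-- Taking `f` to be the inclusion of a subgroup, this says that `F`-subnormality is inherited by
intersections with subgroups. -/
theorem IsFSubnormal.comap (hF : IsFormation F) (hsub : IsSubgroupClosed F)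
    {G K : Type u} [Group G] [Group K] [Finite K] (f : K →* G) {H : Subgroup G}
    (hH : IsFSubnormal F H) : IsFSubnormal F (H.comap f) := by
  induction hH with
  | top => exact .top
  | step H L hmax hquot hL ih =>
    refine isFSubnormal_of_ker_le hF hsub ih
      ((QuotientGroup.mk' (H.subgroupOf L).normalCore).comp (f.subgroupComap L)) hquot _
      (Subgroup.comap_mono hmax.le) fun k hk ↦ ?_
    rw [MonoidHom.mem_ker, MonoidHom.comp_apply, ← MonoidHom.mem_ker, QuotientGroup.ker_mk'] at hk
    exact Subgroup.normalCore_le (H.subgroupOf L) hk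

theorem isFSubnormal_of_commutator_le (hF : IsFormation F) (hsub : IsSubgroupClosed F)
    (hnil : ContainsNilpotent F) {G : Type u} [Group G] [Finite G] {A : Subgroup G}
    (hA : commutator G ≤ A) : IsFSubnormal F A := by
  have : A.Normal := .of_commutator_le _ hA
  have hcomm : IsMulCommutative (G ⧸ A) :=
    Subgroup.Normal.quotient_commutative_iff_commutator_le.mpr hA
  have hQ : F (G ⧸ A) := hnil _ isNilpotent_of_isMulCommutative
  refine isFSubnormal_of_ker_le hF hsub .top
    ((QuotientGroup.mk' A).comp (⊤ : Subgroup G).subtype) hQ A le_top fun k hk ↦ ?_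
  rwa [MonoidHom.mem_ker, MonoidHom.comp_apply, ← MonoidHom.mem_ker, QuotientGroup.ker_mk'] at hk

/-! ### Groups whose primary cyclic subgroups are `F`-subnormal -/

theorem IsPrimaryCyclic.map_subtype {G : Type*} [Group G] {A : Subgroup G} {C : Subgroup A}
    (hC : IsPrimaryCyclic C) : IsPrimaryCyclic (C.map A.subtype) :=
  let e := C.equivMapOfInjective A.subtype A.subtype_injective
  ⟨e.isCyclic.mp hC.1, Nat.card_congr e.toEquiv ▸ hC.2⟩

theorem isPrimaryCyclic_zpowers {G : Type*} [Group G] [Finite G] {p : ℕ} (hp : p.Prime) {y : G}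
    (hy : y ≠ 1) (hpy : ∃ n, y ^ p ^ n = 1) : IsPrimaryCyclic (Subgroup.zpowers y) := by
  have := Fact.mk hp
  obtain ⟨n, hn⟩ := exists_orderOf_eq_prime_pow_iff.mpr hpy
  refine ⟨inferInstance, ?_⟩
  rw [Nat.card_zpowers, hn]
  refine hp.isPrimePow.pow fun h0 ↦ hy ?_
  rwa [h0, pow_zero, orderOf_eq_one_iff] at hn

/-- A soluble group whose primary cyclic subgroups are all `F`-subnormal is, by induction on its
order, the product of a maximal subgroup containing the derived subgroup with a primary cyclic
subgroup, both of them `F`-subnormal and in `F`. -/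
theorem mem_of_forall_isPrimaryCyclic_isFSubnormal (hF : IsFormation F)
    (hsub : IsSubgroupClosed F) (hsup : IsSuperradical F) (hnil : ContainsNilpotent F)
    (G : Type u) [Group G] [Finite G] [Group.IsSolvable G]
    (h : ∀ C : Subgroup G, IsPrimaryCyclic C → IsFSubnormal F C) : F G := by
  induction hn : Nat.card G using Nat.strong_induction_on generalizing G with
  | _ n ih =>
  subst hn
  rcases subsingleton_or_nontrivial G with _ | _
  · exact hnil G inferInstance
  obtain ⟨A, hAmax, hA⟩ := (eq_top_or_exists_le_coatom (commutator G)).resolve_left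
    (Group.IsSolvable.commutator_lt_top_of_nontrivial G).ne
  have : A.Normal := .of_commutator_le _ hA
  have hAF : F A := by
    refine ih _ ?_ A (fun C hC ↦ ?_) rfl
    · refine (Subgroup.card_le_card_group A).lt_of_ne fun h ↦ hAmax.1 (A.eq_top_of_card_eq h)
    · have := (h _ hC.map_subtype).comap hF hsub A.subtype
      rwa [Subgroup.comap_map_eq_self_of_injective A.subtype_injective] at this
  -- Some element of prime power order lies outside `A`.
  obtain ⟨q, hq, hqA⟩ := Nat.exists_prime_and_dvd (mt Subgroup.index_eq_one.mp hAmax.1)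
  have := Fact.mk hq
  have hQ : ¬ ((default : Sylow q G) : Subgroup G) ≤ A := fun hle ↦
    Sylow.not_dvd_index _ (hqA.trans (Subgroup.index_dvd_of_le hle))
  obtain ⟨y, hyQ, hyA⟩ := SetLike.not_le_iff_exists.mp hQ
  have hyC : IsPrimaryCyclic (Subgroup.zpowers y) := by
    refine isPrimaryCyclic_zpowers hq (fun h1 ↦ hyA (h1 ▸ A.one_mem)) ?_
    obtain ⟨k, hk⟩ := (default : Sylow q G).isPGroup' ⟨y, hyQ⟩
    exact ⟨k, congrArg Subtype.val hk⟩
  refine hsup.product G A (Subgroup.zpowers y) (isFSubnormal_of_commutator_le hF hsub hnil hA)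
    (h _ hyC) hAF (hnil _ isNilpotent_of_isMulCommutative) ?_
  rw [← Subgroup.normal_mul, ← Subgroup.coe_top, SetLike.coe_set_eq]
  refine hAmax.2 _ (left_lt_sup.mpr fun hle ↦ hyA (hle (Subgroup.mem_zpowers y)))

/-! ### Self-normalizing Sylow subgroups -/

/-- An overgroup `H` of a self-normalizing Sylow subgroup `P` is self-normalizing: by the Frattini
argument, `N_G(H) = H N_G(P)`. -/
theorem isSelfNormalizing_of_sylow_le {G : Type*} [Group G] [Finite G] {p : ℕ} [Fact p.Prime]
    (P : Sylow p G) (hP : IsSelfNormalizing (P : Subgroup G)) {H : Subgroup G}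
    (hPH : (P : Subgroup G) ≤ H) : IsSelfNormalizing H := by
  refine le_antisymm (fun n hn ↦ ?_) Subgroup.le_normalizer
  have hnP : ((n • P : Sylow p G) : Subgroup G) ≤ H := by
    intro z hz
    rw [Sylow.coe_subgroup_smul, Subgroup.mem_pointwise_smul_iff_inv_smul_mem] at hz
    simpa [MulAut.smul_def, mul_assoc] using (Subgroup.mem_normalizer_iff.mp hn _).mp (hPH hz)
  obtain ⟨h, hh⟩ := MulAction.exists_smul_eq H ((n • P).subtype hnP) (P.subtype hPH)
  simp_rw [Sylow.smul_subtype, Subgroup.smul_def, smul_smul] at hh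
  have hmem := Sylow.smul_eq_iff_mem_normalizer.mp (Sylow.subtype_injective hh)
  have hP' : (h : G) * n ∈ (P : Subgroup G) := hP ▸ hmem
  exact (H.mul_mem_cancel_left h.2).mp (hPH hP')

/-- A self-normalizing `p`-subgroup is a Sylow `p`-subgroup. -/
theorem not_dvd_index_of_isSelfNormalizing {G : Type*} [Group G] [Finite G] {p : ℕ}
    [hp : Fact p.Prime] {C : Subgroup G} (hC : IsPGroup p C) (hself : IsSelfNormalizing C) :
    ¬ p ∣ C.index := by
  intro hdvd
  obtain ⟨n, hn⟩ := IsPGroup.iff_card.mp hC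
  have h1 : p ^ (n + 1) ∣ Nat.card G := by
    rw [← C.card_mul_index, hn, pow_succ]
    exact mul_dvd_mul_left _ hdvd
  have h2 := Sylow.prime_dvd_card_quotient_normalizer h1 hn
  have h3 : Subgroup.comap (Subgroup.normalizer (C : Set G)).subtype C = ⊤ :=
    Subgroup.subgroupOf_eq_top.mpr hself.le
  rw [← Subgroup.index_eq_card, h3, Subgroup.index_top] at h2
  exact hp.1.one_lt.ne' (Nat.dvd_one.mp h2)

/-- An abelian self-normalizing Sylow subgroup lies in the centre of its normalizer, so Burnside's
transfer theorem provides a normal complement; this complement is the derived subgroup. -/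
theorem isComplement'_commutator_of_sylow {G : Type*} [Group G] [Finite G] {p : ℕ} [Fact p.Prime]
    (P : Sylow p G) [IsMulCommutative P] (hP : IsSelfNormalizing (P : Subgroup G)) :
    (commutator G).IsComplement' P := by
  have hle : Subgroup.normalizer ((P : Subgroup G) : Set G) ≤ Subgroup.centralizer (P : Set G) :=
    hP.le.trans (Subgroup.le_centralizer _)
  have hK := MonoidHom.ker_transferSylow_isComplement' P hle
  have hKP : commutator G ≤ (MonoidHom.transferSylow P hle).ker :=
    Subgroup.Normal.commutator_le_of_self_sup_commutative_eq_top hK.sup_eq_top inferInstance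
  -- `G'P` is normal, as it contains `G'`, and self-normalizing, as it contains `P`.
  have htop : commutator G ⊔ P = ⊤ := by
    have hN : (commutator G ⊔ (P : Subgroup G)).Normal := .of_commutator_le _ le_sup_left
    have hs := isSelfNormalizing_of_sylow_le P hP (H := commutator G ⊔ P) le_sup_right
    exact hs.symm.trans (Subgroup.normalizer_eq_top_iff.mpr hN)
  have hdisj : commutator G ⊓ P = ⊥ := (hK.disjoint.mono_left hKP).eq_bot
  refine Subgroup.isComplement'_of_disjoint_and_mul_eq_univ (disjoint_iff.mpr hdisj) ?_
  rw [← Subgroup.normal_mul, htop, Subgroup.coe_top]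

theorem IsPrimaryCyclic.exists_sylow_eq {G : Type*} [Group G] [Finite G] {C : Subgroup G}
    (hC : IsPrimaryCyclic C) (hself : IsSelfNormalizing C) :
    ∃ (p : ℕ) (P : Sylow p G), p.Prime ∧ p ∣ Nat.card C ∧ (P : Subgroup G) = C := by
  obtain ⟨p, k, hp, hk, hcard⟩ := hC.2
  have := Fact.mk hp.nat_prime
  have hpC : IsPGroup p C := IsPGroup.of_card hcard.symm
  exact ⟨p, hpC.toSylow (not_dvd_index_of_isSelfNormalizing hpC hself), hp.nat_prime,
    hcard ▸ dvd_pow_self p hk.ne', rfl⟩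

theorem IsPrimaryCyclic.isComplement'_commutator {G : Type*} [Group G] [Finite G] {C : Subgroup G}
    (hC : IsPrimaryCyclic C) (hself : IsSelfNormalizing C) :
    (commutator G).IsComplement' C := by
  obtain ⟨p, P, hp, -, rfl⟩ := hC.exists_sylow_eq hself
  have := Fact.mk hp
  have := hC.1
  have : IsMulCommutative P := inferInstance
  exact isComplement'_commutator_of_sylow P hself

/-! ### Subgroups of `G' ⋊ ⟨x⟩` -/

theorem commutator_sup_zpowers_pow_ne_top {G : Type*} [Group G] [Finite G] {x : G} {p : ℕ}
    (hp : p.Prime) (hpx : p ∣ orderOf x)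
    (hx : (commutator G).IsComplement' (Subgroup.zpowers x)) :
    commutator G ⊔ Subgroup.zpowers (x ^ p) ≠ ⊤ := by
  intro h
  have hle : Subgroup.zpowers (x ^ p) ≤ Subgroup.zpowers x :=
    Subgroup.zpowers_le.mpr (Subgroup.npow_mem_zpowers x p)
  have hx' : (commutator G).IsComplement' (Subgroup.zpowers (x ^ p)) := by
    refine Subgroup.isComplement'_of_disjoint_and_mul_eq_univ (hx.disjoint.mono_right hle) ?_
    rw [← Subgroup.normal_mul, h, Subgroup.coe_top]
  have h2 := hx.card_mul_card.trans hx'.card_mul_card.symm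
  have h3 := Nat.eq_of_mul_eq_mul_left Nat.card_pos h2
  rw [Nat.card_zpowers, Nat.card_zpowers, orderOf_pow_of_dvd hp.ne_zero hpx] at h3
  exact (Nat.div_lt_self (orderOf_pos x) hp.one_lt).ne' h3

/-- As `G / G'` is a cyclic `p`-group generated by the image of `x`, each of its proper subgroups
lies in the subgroup generated by the image of `x ^ p`. -/
theorem commutator_sup_eq_top_of_not_le {G : Type*} [Group G] [Finite G] {x : G} {p : ℕ}
    [hp : Fact p.Prime] {n : ℕ} (hn : orderOf x = p ^ n)
    (hx : (commutator G).IsComplement' (Subgroup.zpowers x)) {H : Subgroup G}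
    (hH : ¬ H ≤ commutator G ⊔ Subgroup.zpowers (x ^ p)) : commutator G ⊔ H = ⊤ := by
  obtain ⟨h, hhH, hh⟩ := SetLike.not_le_iff_exists.mp hH
  have hmem : h ∈ commutator G ⊔ Subgroup.zpowers x := hx.sup_eq_top ▸ Subgroup.mem_top h
  obtain ⟨g, hg, _, ⟨k, rfl⟩, rfl⟩ := Subgroup.mem_sup_of_normal_left.mp hmem
  have hk : IsCoprime k (orderOf x : ℤ) := by
    rw [hn, Nat.cast_pow]
    refine IsCoprime.pow_right ?_
    refine ((Nat.prime_iff_prime_int.mp hp.1).coprime_iff_not_dvd.mpr ?_).symm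
    rintro ⟨m, rfl⟩
    -- If `p ∣ k`, then `g * x ^ k` would lie in `G'⟨x ^ p⟩`.
    refine hh (Subgroup.mul_mem_sup hg ⟨m, ?_⟩)
    simp [zpow_mul]
  have hxk : x ^ k ∈ commutator G ⊔ H := by
    have := mul_mem (inv_mem ((le_sup_left : _ ≤ commutator G ⊔ H) hg))
      ((le_sup_right : H ≤ commutator G ⊔ H) hhH)
    simpa using this
  have hxmem : x ∈ commutator G ⊔ H := by
    obtain ⟨a, b, hab⟩ := hk
    have : x = (x ^ k) ^ a := by
      conv_lhs => rw [← zpow_one x, ← hab]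
      rw [zpow_add, mul_comm b, zpow_mul x (orderOf x : ℤ), zpow_natCast, pow_orderOf_eq_one,
        one_zpow, mul_one, mul_comm a, zpow_mul]
    rw [this]
    exact zpow_mem hxk a
  rw [eq_top_iff, ← hx.sup_eq_top]
  exact sup_le le_sup_left (Subgroup.zpowers_le.mpr hxmem)

/-- Since `G'` has order prime to `p`, so has the index of `H`; hence `H` contains a conjugate of
`P`. -/
theorem isSelfNormalizing_of_commutator_sup_eq_top {G : Type*} [Group G] [Finite G] {p : ℕ}
    [hp : Fact p.Prime] (P : Sylow p G) (hself : IsSelfNormalizing (P : Subgroup G))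
    (hP : (commutator G).IsComplement' P) {H : Subgroup G} (hH : commutator G ⊔ H = ⊤) :
    IsSelfNormalizing H := by
  have hHindex : ¬ p ∣ H.index := by
    have h1 : H.index ∣ Nat.card (commutator G) := by
      have h2 : (commutator G).index ∣ Nat.card H := by
        rw [← Subgroup.relIndex_top_right, ← hH, sup_comm, Subgroup.relIndex_sup_right]
        exact Subgroup.relIndex_dvd_card _ _
      obtain ⟨m, hm⟩ := h2
      refine ⟨m, Nat.eq_of_mul_eq_mul_right (Nat.pos_of_ne_zero
        (commutator G).index_ne_zero_of_finite) ?_⟩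
      rw [(commutator G).card_mul_index, ← H.card_mul_index, hm]
      ring
    exact fun h ↦ P.not_dvd_index (hP.index_eq_card ▸ h.trans h1)
  let Q : Sylow p H := default
  have hQp : IsPGroup p ((Q : Subgroup H).map H.subtype) := Q.2.map _
  have hQi : ¬ p ∣ ((Q : Subgroup H).map H.subtype).index := by
    rw [Subgroup.index_map_subtype]
    exact hp.1.not_dvd_mul Q.not_dvd_index hHindex
  obtain ⟨g, hg⟩ := MulAction.exists_smul_eq G P (hQp.toSylow hQi)
  refine isSelfNormalizing_of_sylow_le (g • P) ?_ ?_
  · refine le_antisymm (fun n hn ↦ ?_) Subgroup.le_normalizer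
    have hn' : (g⁻¹ * (n * g)) • P = P := by
      rw [mul_smul, mul_smul, Sylow.smul_eq_iff_mem_normalizer.mpr hn, inv_smul_smul]
    have hnP : g⁻¹ * (n * g) ∈ (P : Subgroup G) :=
      hself ▸ Sylow.smul_eq_iff_mem_normalizer.mp hn'
    rw [Sylow.coe_subgroup_smul, Subgroup.mem_pointwise_smul_iff_inv_smul_mem]
    simpa [MulAut.smul_def, mul_assoc] using hnP
  · rw [hg]
    exact Subgroup.map_subtype_le _

end GroupFormation

open GroupFormation in
theorem theorem1 (F : GroupFormation.GroupClass.{u})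
    (hform : GroupFormation.IsFormation F)
    (hsub : GroupFormation.IsSubgroupClosed F)
    (hsat : GroupFormation.IsSaturated F)
    (hsup : GroupFormation.IsSuperradical F)
    (hnil : GroupFormation.ContainsNilpotent F)
    (G : Type u) [Group G] [Finite G] (hsol : Group.IsSolvable G) (hG : ¬ F G) :
    List.TFAE
      [∀ H : Subgroup G, GroupFormation.IsPrimaryCyclic H →
          GroupFormation.IsSelfNormalizing H ∨ GroupFormation.IsFSubnormal F H,
        ∀ H : Subgroup G, H ≠ ⊤ →
          GroupFormation.IsSelfNormalizing H ∨ GroupFormation.IsFSubnormal F H,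
        ∃ (p : ℕ) (x : G), p.Prime ∧ p ∣ Nat.card G ∧
          (commutator G).IsComplement' (Subgroup.zpowers x) ∧
          (∃ P : Sylow p G, (P : Subgroup G) = Subgroup.zpowers x) ∧
          GroupFormation.IsCarter (Subgroup.zpowers x) ∧
          F ↥(commutator G ⊔ Subgroup.zpowers (x ^ p))] := by
  tfae_have 2 → 1 := by
    intro h H _
    rcases eq_or_ne H ⊤ with rfl | hH
    · exact .inr .top
    · exact h H hH
  tfae_have 1 → 3 := by
    intro h
    obtain ⟨C, hC, hCn⟩ : ∃ C : Subgroup G, IsPrimaryCyclic C ∧ ¬ IsFSubnormal F C := by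
      by_contra! hcon
      exact hG (mem_of_forall_isPrimaryCyclic_isFSubnormal hform hsub hsup hnil G hcon)
    have hself := (h C hC).resolve_right hCn
    have hcompl := hC.isComplement'_commutator hself
    obtain ⟨p, P, hp, hpC, hPC⟩ := hC.exists_sylow_eq hself
    obtain ⟨x, rfl⟩ := (Subgroup.isCyclic_iff_exists_zpowers_eq_top C).mp hC.1
    refine ⟨p, x, hp, hpC.trans (Subgroup.card_subgroup_dvd_card _), hcompl, ⟨P, hPC⟩,
      ⟨isNilpotent_of_isMulCommutative, hself⟩, ?_⟩
    have hne := commutator_sup_zpowers_pow_ne_top hp (Nat.card_zpowers x ▸ hpC) hcompl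
    set M := commutator G ⊔ Subgroup.zpowers (x ^ p)
    refine mem_of_forall_isPrimaryCyclic_isFSubnormal hform hsub hsup hnil M fun D hD ↦ ?_
    have hD' : IsPrimaryCyclic (D.map M.subtype) := hD.map_subtype
    rcases h _ hD' with hDself | hDsub
    · refine absurd ?_ hne
      rw [eq_top_iff, ← (hD'.isComplement'_commutator hDself).sup_eq_top]
      exact sup_le le_sup_left (Subgroup.map_subtype_le D)
    · have := hDsub.comap hform hsub M.subtype
      rwa [Subgroup.comap_map_eq_self_of_injective M.subtype_injective] at this
  tfae_have 3 → 2 := by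
    rintro ⟨p, x, hp, hpG, hcompl, ⟨P, hP⟩, ⟨-, hself⟩, hMF⟩ H -
    have := Fact.mk hp
    by_cases hH : H ≤ commutator G ⊔ Subgroup.zpowers (x ^ p)
    · refine .inr (isFSubnormal_of_ker_le hform hsub
        (isFSubnormal_of_commutator_le hform hsub hnil le_sup_left) (MonoidHom.id _) hMF H hH ?_)
      simp
    · obtain ⟨n, hn⟩ := IsPGroup.iff_card.mp P.2
      rw [hP, Nat.card_zpowers] at hn
      rw [← hP] at hself
      exact .inl (isSelfNormalizing_of_commutator_sup_eq_top P hself (hP ▸ hcompl)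
        (commutator_sup_eq_top_of_not_le hn hcompl hH))
  tfae_finish
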